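/- For an integer $k\ge 2$ and real $c$ let $$\gamma_k(c)=\frac{1}{k!\,G(1+k)^2}\int_{[0,1]^k}\delta(t_1+\cdots+t_k-c)\prod_{1\le i<j\le k}(t_i-t_j)^2\,dt_1\cdots dt_k ,\qquad G(1+k)=1!\,2!\cdots(k-1)!,$$ where $\delta$ is the Dirac delta function; that is, $$\gamma_k(c)=\frac{1}{k!\,G(1+k)^2}\int_{D_k(c)}\ \prod_{1\le i<j\le k}(t_i-t_j)^2\,dt_1\cdots dt_{k-1},\qquad t_k:=c-t_1-\cdots-t_{k-1},$$ with $D_k(c)=\{(t_1,\dots,t_{k-1})\in[0,1]^{k-1}: 0\le t_k\le 1\}$. Then $\gamma_k$ is $\left(\left\lfloor\frac{k^2+1}{2}\right\rfloor-2\right)$-times differentiable at every point of the open interval $0<c<k$, and its derivatives up to and including that order are continuous there (for $k=2$, where the order is $0$, this says that $\gamma_2$ is continuous on $(0,2)$). -/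

import Mathlib

/-- The value `G (1 + k) = 1! * 2! * ⋯ * (k - 1)!` of the Barnes `G`-function at a positive
integer (the factor `0! = 1` is harmless). -/
def barnesGOnePlus (k : ℕ) : ℕ := ∏ j ∈ Finset.range k, j.factorial

/-- The point `(t₁, …, tₙ, c - (t₁ + ⋯ + tₙ))` of the hyperplane `x₁ + ⋯ + xₙ₊₁ = c`. -/
def hyperplanePoint (n : ℕ) (c : ℝ) (t : Fin n → ℝ) : Fin (n + 1) → ℝ :=
  Fin.snoc (α := fun _ => ℝ) t (c - ∑ i, t i)

/-- The squared Vandermonde product `∏_{i < j} (x i - x j) ^ 2`. -/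
def vandermondeSq {n : ℕ} (x : Fin n → ℝ) : ℝ :=
  ∏ i, ∏ j ∈ Finset.Ioi i, (x i - x j) ^ 2

/-- `∫_{[0,1]^(n+1)} δ(x₁ + ⋯ + xₙ₊₁ - c) ∏_{i<j} (x i - x j)² dx`: the delta function is integrated
out against the last variable, so that `xₙ₊₁ = c - (x₁ + ⋯ + xₙ)`, and one integrates over those
`(x₁, …, xₙ)` for which all `n + 1` coordinates lie in `[0,1]`. -/
noncomputable def deltaVandermondeIntegral (n : ℕ) (c : ℝ) : ℝ :=
  ∫ t in {t : Fin n → ℝ | ∀ i, hyperplanePoint n c t i ∈ Set.Icc (0 : ℝ) 1},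
    vandermondeSq (hyperplanePoint n c t)

/-- The function `γ_k(c)`, with `k` a positive integer (the value at `k = 0` is irrelevant). -/
noncomputable def gammaFn : ℕ → ℝ → ℝ
  | 0, _ => 0
  | n + 1, c =>
      1 / (((n + 1).factorial : ℝ) * (barnesGOnePlus (n + 1) : ℝ) ^ 2) *
        deltaVandermondeIntegral n c

/-! In each coordinate 1_[0,1] = 1_[0,∞) - 1_(1,∞), so the cube is a signed sum of orthants based at
its vertices. Moving each vertex to the origin gives slice integrals at level c - |S|
(`deltaVandermondeIntegral_eq_sum`). By scaling, an integrand homogeneous of degree d contributes a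
constant times (c - |S|)_+^(k-1+d), which is C^(k-2+d) (`orthantSliceIntegral_of_homogeneous`).
Expanded at a vertex, the squared Vandermonde product has only terms of degree at least twice the
number of pairs not separated by S. That is at least k²/2 - k, balanced splits being the worst
(`sq_le_two_mul_vandermondeOrder`). The resulting order is k - 2 + ⌈k²/2 - k⌉ = ⌊(k²+1)/2⌋ - 2, on
all of ℝ. -/

open MeasureTheory

/-! ### Truncated powers -/

/-- The truncated power `(max u 0) ^ (N + 1)` is of class `C^N`. -/
theorem contDiff_max_zero_pow_succ (N : ℕ) :
    ContDiff ℝ (N : WithTop ℕ∞) (fun u : ℝ => max u 0 ^ (N + 1)) := by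
  induction N with
  | zero => exact contDiff_zero.2 (by fun_prop)
  | succ N ih =>
    have hd : ∀ u : ℝ, HasDerivAt (fun u : ℝ => max u 0 ^ (N + 2))
        (((N + 2 : ℕ) : ℝ) * max u 0 ^ (N + 1)) u := by
      intro u
      rcases lt_trichotomy u 0 with hu | rfl | hu
      · have h : (fun u : ℝ => max u 0 ^ (N + 2)) =ᶠ[nhds u] fun _ => 0 := by
          filter_upwards [Iio_mem_nhds hu] with v hv
          simp [max_eq_right (Set.mem_Iio.1 hv).le]
        simpa [max_eq_right hu.le] using (hasDerivAt_const u (0 : ℝ)).congr_of_eventuallyEq h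
      · have hO : (fun v : ℝ => max v 0 ^ (N + 2)) =o[nhds 0] fun v : ℝ => v := by
          have h1 : (fun v : ℝ => max v 0 ^ (N + 2)) =O[nhds 0] fun v : ℝ => v ^ (N + 2) := by
            refine Asymptotics.isBigO_of_le _ fun v => ?_
            rw [norm_pow, norm_pow]
            refine pow_le_pow_left₀ (norm_nonneg _) ?_ _
            rw [Real.norm_eq_abs, Real.norm_eq_abs, abs_of_nonneg (le_max_right v 0)]
            exact max_le (le_abs_self v) (abs_nonneg v)
          refine h1.trans_isLittleO ?_
          simpa using Asymptotics.isLittleO_pow_pow (𝕜 := ℝ) (m := 1) (n := N + 2) (by omega)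
        rw [hasDerivAt_iff_isLittleO]
        simpa using hO
      · have h : (fun u : ℝ => max u 0 ^ (N + 2)) =ᶠ[nhds u] fun v => v ^ (N + 2) := by
          filter_upwards [Ioi_mem_nhds hu] with v hv
          simp [max_eq_left (Set.mem_Ioi.1 hv).le]
        simpa [max_eq_left hu.le] using (hasDerivAt_pow (N + 2) u).congr_of_eventuallyEq h
    have := (contDiff_succ_iff_deriv (𝕜 := ℝ) (n := (N : WithTop ℕ∞))
      (f := fun u : ℝ => max u 0 ^ (N + 2))).2
      ⟨fun u => (hd u).differentiableAt, by simp, by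
        rw [show deriv (fun u : ℝ => max u 0 ^ (N + 2)) = _ from funext fun u => (hd u).deriv]
        exact contDiff_const.mul ih⟩
    simpa using this

theorem contDiff_max_zero_pow {N p : ℕ} (h : N < p) :
    ContDiff ℝ (N : WithTop ℕ∞) (fun u : ℝ => max u 0 ^ p) := by
  obtain ⟨q, rfl⟩ : ∃ q, p = q + 1 := ⟨p - 1, by omega⟩
  exact (contDiff_max_zero_pow_succ q).of_le (by exact_mod_cast Nat.lt_succ_iff.1 h)

/-! ### Slices of orthants -/

/-- The orthant of points with nonnegative coordinates, those indexed by `S` being positive. -/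
def mixedOrthant {n : ℕ} (S : Finset (Fin n)) : Set (Fin n → ℝ) :=
  {x | ∀ i, 0 ≤ x i ∧ (i ∈ S → 0 < x i)}

theorem measurableSet_mixedOrthant {n : ℕ} (S : Finset (Fin n)) :
    MeasurableSet (mixedOrthant S) := by
  have : mixedOrthant S = ⋂ i, {x | 0 ≤ x i ∧ (i ∈ S → 0 < x i)} := by
    ext x; simp [mixedOrthant]
  rw [this]
  exact MeasurableSet.iInter fun i =>
    (measurableSet_le measurable_const (measurable_pi_apply i)).inter
      ((MeasurableSet.const _).imp (measurableSet_lt measurable_const (measurable_pi_apply i)))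

theorem smul_mem_mixedOrthant_iff {n : ℕ} {S : Finset (Fin n)} {u : ℝ} (hu : 0 < u)
    {x : Fin n → ℝ} : u • x ∈ mixedOrthant S ↔ x ∈ mixedOrthant S := by
  simp [mixedOrthant, hu]

theorem sum_hyperplanePoint (n : ℕ) (c : ℝ) (t : Fin n → ℝ) :
    ∑ i, hyperplanePoint n c t i = c := by
  simp [hyperplanePoint, Fin.sum_univ_castSucc]

theorem continuous_hyperplanePoint (n : ℕ) (c : ℝ) : Continuous (hyperplanePoint n c) := by
  refine continuous_pi fun i => ?_
  induction i using Fin.lastCases with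
  | last => simp only [hyperplanePoint, Fin.snoc_last]; fun_prop
  | cast i => simp only [hyperplanePoint, Fin.snoc_castSucc]; fun_prop

theorem hyperplanePoint_smul (n : ℕ) (u c : ℝ) (t : Fin n → ℝ) :
    hyperplanePoint n (u * c) (u • t) = u • hyperplanePoint n c t := by
  ext i
  induction i using Fin.lastCases with
  | last => simp [hyperplanePoint, mul_sub, Finset.mul_sum]
  | cast i => simp [hyperplanePoint]

theorem hyperplanePoint_sub (n : ℕ) (c : ℝ) (t : Fin n → ℝ) (a : Fin (n + 1) → ℝ) :
    hyperplanePoint n c t - a =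
      hyperplanePoint n (c - ∑ i, a i) (t - fun i => a i.castSucc) := by
  ext i
  induction i using Fin.lastCases with
  | last => simp [hyperplanePoint, Fin.sum_univ_castSucc]; ring
  | cast i => simp [hyperplanePoint]

/-- The points of an orthant on a given hyperplane have bounded coordinates. -/
theorem mem_Icc_of_hyperplanePoint_mem {n : ℕ} {S : Finset (Fin (n + 1))} {c : ℝ}
    {t : Fin n → ℝ} (h : hyperplanePoint n c t ∈ mixedOrthant S) :
    t ∈ Set.Icc (0 : Fin n → ℝ) (fun _ => c) := by
  have h0 : ∀ i : Fin n, t i = hyperplanePoint n c t i.castSucc := fun i => by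
    simp [hyperplanePoint]
  refine ⟨fun i => ?_, fun i => ?_⟩
  · rw [h0]; exact (h _).1
  · rw [h0]
    calc hyperplanePoint n c t i.castSucc ≤ ∑ j, hyperplanePoint n c t j :=
          Finset.single_le_sum (fun j _ => (h j).1) (Finset.mem_univ _)
      _ = c := sum_hyperplanePoint n c t

/-- The integral of `f` over the part of an orthant on the hyperplane with coordinate sum `c`. -/
noncomputable def orthantSliceIntegral {n : ℕ} (S : Finset (Fin (n + 1)))
    (f : (Fin (n + 1) → ℝ) → ℝ) (c : ℝ) : ℝ :=
  ∫ t, (mixedOrthant S).indicator f (hyperplanePoint n c t)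

theorem integrable_orthantSlice {n : ℕ} (S : Finset (Fin (n + 1)))
    {f : (Fin (n + 1) → ℝ) → ℝ} (hf : Continuous f) (c : ℝ) :
    Integrable (fun t => (mixedOrthant S).indicator f (hyperplanePoint n c t)) := by
  have hm : MeasurableSet (hyperplanePoint n c ⁻¹' mixedOrthant S) :=
    (continuous_hyperplanePoint n c).measurable (measurableSet_mixedOrthant S)
  have h : IntegrableOn (fun t => f (hyperplanePoint n c t))
      (hyperplanePoint n c ⁻¹' mixedOrthant S) :=
    ((hf.comp (continuous_hyperplanePoint n c)).continuousOn.integrableOn_compact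
      (isCompact_Icc (a := (0 : Fin n → ℝ)) (b := fun _ => c))).mono_set
      fun t ht => mem_Icc_of_hyperplanePoint_mem ht
  exact (integrable_indicator_iff hm).2 h

/-- The slice integral of a homogeneous function of degree `d` is a truncated power. -/
theorem orthantSliceIntegral_of_homogeneous {n : ℕ} (hn : n ≠ 0) (S : Finset (Fin (n + 1)))
    {f : (Fin (n + 1) → ℝ) → ℝ} {d : ℕ} (hf : ∀ (u : ℝ) x, f (u • x) = u ^ d * f x) (c : ℝ) :
    orthantSliceIntegral S f c = orthantSliceIntegral S f 1 * max c 0 ^ (n + d) := by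
  rcases le_or_gt c 0 with hc | hc
  -- For c ≤ 0 the slice lies in {0}, a null set only because n ≠ 0.
  · have h0 : (fun t => (mixedOrthant S).indicator f (hyperplanePoint n c t)) =ᵐ[volume] 0 := by
      have : Nonempty (Fin n) := ⟨⟨0, by omega⟩⟩
      have : ∀ᵐ t : Fin n → ℝ, t ≠ 0 := by simp [ae_iff]
      filter_upwards [this] with t ht
      refine Set.indicator_of_notMem (fun hmem => ht ?_) _
      obtain ⟨h1, h2⟩ := mem_Icc_of_hyperplanePoint_mem hmem
      exact le_antisymm (fun i => (h2 i).trans hc) h1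
    rw [orthantSliceIntegral, integral_congr_ae h0, max_eq_right hc]
    simp [hn]
  -- Substituting t ↦ c • t gives c ^ n from the Jacobian and c ^ d from homogeneity.
  · have h := Measure.integral_comp_smul (volume : Measure (Fin n → ℝ))
      (fun t => (mixedOrthant S).indicator f (hyperplanePoint n c t)) c
    have h2 : ∀ t, (mixedOrthant S).indicator f (hyperplanePoint n c (c • t)) =
        c ^ d * (mixedOrthant S).indicator f (hyperplanePoint n 1 t) := by
      intro t
      have := hyperplanePoint_smul n c 1 t
      rw [mul_one] at this
      rw [this]
      by_cases ht : hyperplanePoint n 1 t ∈ mixedOrthant S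
      · rw [Set.indicator_of_mem ht, Set.indicator_of_mem ((smul_mem_mixedOrthant_iff hc).2 ht), hf]
      · rw [Set.indicator_of_notMem ht,
          Set.indicator_of_notMem (mt (smul_mem_mixedOrthant_iff hc).1 ht), mul_zero]
    simp only [h2, integral_const_mul, Module.finrank_fin_fun, smul_eq_mul] at h
    rw [abs_of_pos (by positivity)] at h
    rw [max_eq_left hc.le, orthantSliceIntegral, orthantSliceIntegral]
    have hcn : c ^ n ≠ 0 := by positivity
    field_simp at h
    rw [← h]; ring

/-! ### Combinations of homogeneous functions -/

/-- The span of the continuous homogeneous functions of degree at least `r`. -/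
def homogeneousSpan (n r : ℕ) : Submodule ℝ ((Fin n → ℝ) → ℝ) :=
  Submodule.span ℝ {f | Continuous f ∧ ∃ d, r ≤ d ∧ ∀ (u : ℝ) x, f (u • x) = u ^ d * f x}

theorem mul_mem_homogeneousSpan {n r s : ℕ} {f g : (Fin n → ℝ) → ℝ}
    (hf : f ∈ homogeneousSpan n r) (hg : g ∈ homogeneousSpan n s) :
    f * g ∈ homogeneousSpan n (r + s) := by
  have h := Submodule.mul_mem_mul hf hg
  rw [homogeneousSpan, homogeneousSpan, Submodule.span_mul_span] at h
  refine Submodule.span_mono ?_ h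
  rintro _ ⟨a, ⟨ha, d, hd, had⟩, b, ⟨hb, e, he, hbe⟩, rfl⟩
  refine ⟨ha.mul hb, d + e, by omega, fun u x => ?_⟩
  simp only [Pi.mul_apply, had, hbe]
  ring

theorem one_mem_homogeneousSpan (n : ℕ) : (1 : (Fin n → ℝ) → ℝ) ∈ homogeneousSpan n 0 :=
  Submodule.subset_span ⟨continuous_one, 0, le_rfl, by simp⟩

theorem prod_mem_homogeneousSpan {n : ℕ} {ι : Type*} (s : Finset ι)
    (f : ι → (Fin n → ℝ) → ℝ) (r : ι → ℕ) (h : ∀ i ∈ s, f i ∈ homogeneousSpan n (r i)) :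
    ∏ i ∈ s, f i ∈ homogeneousSpan n (∑ i ∈ s, r i) := by
  classical
  induction s using Finset.induction_on with
  | empty => simpa using one_mem_homogeneousSpan n
  | insert a s ha ih =>
    rw [Finset.prod_insert ha, Finset.sum_insert ha]
    exact mul_mem_homogeneousSpan (h _ (by simp)) (ih fun i hi => h i (by simp [hi]))

theorem sub_sq_mem_homogeneousSpan {n : ℕ} (i j : Fin n) :
    (fun x : Fin n → ℝ => (x i - x j) ^ 2) ∈ homogeneousSpan n 2 :=
  Submodule.subset_span ⟨by fun_prop, 2, le_rfl, fun u x => by simp; ring⟩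

theorem sub_add_const_sq_mem_homogeneousSpan {n : ℕ} (i j : Fin n) (a : ℝ) :
    (fun x : Fin n → ℝ => (x i - x j + a) ^ 2) ∈ homogeneousSpan n 0 := by
  have h : (fun x : Fin n → ℝ => x i - x j + a) ∈ homogeneousSpan n 0 := by
    refine Submodule.add_mem _ (x := fun x : Fin n → ℝ => x i - x j) (y := fun _ => a)
      (Submodule.subset_span ⟨by fun_prop, 1, by omega, fun u x => by simp; ring⟩)
      (Submodule.subset_span ⟨by fun_prop, 0, le_rfl, fun u x => by simp⟩)
  have h2 := mul_mem_homogeneousSpan h h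
  rw [← sq] at h2
  exact h2

/-- The slice integral of a combination of homogeneous functions of degree at least `r` has
continuous derivatives up to order `n + r - 1`. -/
theorem contDiff_orthantSliceIntegral {n : ℕ} (hn : n ≠ 0) (S : Finset (Fin (n + 1)))
    {r N : ℕ} (hN : N < n + r) {f : (Fin (n + 1) → ℝ) → ℝ} (hf : f ∈ homogeneousSpan (n + 1) r) :
    Continuous f ∧ ContDiff ℝ (N : WithTop ℕ∞) (orthantSliceIntegral S f) := by
  induction hf using Submodule.span_induction with
  | mem f h =>
    obtain ⟨hc, d, hd, hfd⟩ := h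
    refine ⟨hc, ?_⟩
    rw [funext (orthantSliceIntegral_of_homogeneous hn S hfd)]
    exact contDiff_const.mul (contDiff_max_zero_pow (by omega))
  | zero =>
    refine ⟨continuous_zero, ?_⟩
    have : orthantSliceIntegral S (0 : (Fin (n + 1) → ℝ) → ℝ) = fun _ => 0 := by
      funext c; simp [orthantSliceIntegral]
    rw [this]; exact contDiff_const
  | add f g _ _ ihf ihg =>
    refine ⟨ihf.1.add ihg.1, ?_⟩
    have : orthantSliceIntegral S (f + g) =
        fun c => orthantSliceIntegral S f c + orthantSliceIntegral S g c := by
      funext c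
      rw [orthantSliceIntegral, orthantSliceIntegral, orthantSliceIntegral,
        ← integral_add (integrable_orthantSlice S ihf.1 c) (integrable_orthantSlice S ihg.1 c)]
      simp [Set.indicator_add']
    rw [this]; exact ihf.2.add ihg.2
  | smul a f _ ihf =>
    refine ⟨ihf.1.const_smul a, ?_⟩
    have : orthantSliceIntegral S (a • f) = fun c => a * orthantSliceIntegral S f c := by
      funext c
      rw [orthantSliceIntegral, orthantSliceIntegral, ← integral_const_mul]
      refine integral_congr_ae (Filter.Eventually.of_forall fun t => ?_)
      by_cases ht : hyperplanePoint n c t ∈ mixedOrthant S <;> simp [ht]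
    rw [this]; exact contDiff_const.mul ihf.2

/-! ### Vanishing order at the vertices -/

/-- The `0`-`1` vector of a set of coordinates. -/
def vertex {n : ℕ} (S : Finset (Fin n)) : Fin n → ℝ := fun i => if i ∈ S then 1 else 0

theorem sum_vertex {n : ℕ} (S : Finset (Fin n)) : ∑ i, vertex S i = S.card := by
  simp [vertex]

/-- The vanishing order of `vandermondeSq` at `vertex S`. -/
def vandermondeOrder {n : ℕ} (S : Finset (Fin n)) : ℕ :=
  ∑ i, ∑ j ∈ Finset.Ioi i, if (i ∈ S ↔ j ∈ S) then 2 else 0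

theorem vandermondeSq_add_vertex_mem {n : ℕ} (S : Finset (Fin n)) :
    (fun x => vandermondeSq (x + vertex S)) ∈ homogeneousSpan n (vandermondeOrder S) := by
  have h : (fun x => vandermondeSq (x + vertex S)) = ∏ i, ∏ j ∈ Finset.Ioi i,
      fun x : Fin n → ℝ => (x i - x j + (vertex S i - vertex S j)) ^ 2 := by
    funext x
    simp only [vandermondeSq, Finset.prod_apply, Pi.add_apply]
    refine Finset.prod_congr rfl fun i _ => Finset.prod_congr rfl fun j _ => ?_
    ring
  rw [h]
  refine prod_mem_homogeneousSpan _ _ _ fun i _ => prod_mem_homogeneousSpan _ _ _ fun j _ => ?_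
  split_ifs with hij
  · have : vertex S i - vertex S j = 0 := by simp [vertex, hij]
    simpa only [this, add_zero] using sub_sq_mem_homogeneousSpan i j
  · exact sub_add_const_sq_mem_homogeneousSpan i j _

theorem two_mul_sum_sum_Ioi_mul {R : Type*} [CommRing R] {n : ℕ} (e : Fin n → R) :
    2 * ∑ i : Fin n, ∑ j ∈ Finset.Ioi i, e i * e j = (∑ i, e i) ^ 2 - ∑ i, e i ^ 2 := by
  induction n with
  | zero => simp
  | succ n ih =>
    have := ih fun i => e i.succ
    simp only [Fin.sum_univ_succ, Fin.sum_Ioi_zero, Fin.sum_Ioi_succ, ← Finset.mul_sum] at this ⊢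
    linear_combination this

/-- With signs e i = ±1 recording membership in S, a pair contributes 1 + e i * e j to the order.
Summing over pairs gives 2 * order + 2 * n = n² + (∑ e i)². -/
theorem sq_le_two_mul_vandermondeOrder {n : ℕ} (S : Finset (Fin n)) :
    n ^ 2 ≤ 2 * (vandermondeOrder S + n) := by
  set e : Fin n → ℤ := fun i => if i ∈ S then 1 else -1 with he
  have h1 := two_mul_sum_sum_Ioi_mul e
  have h2 := two_mul_sum_sum_Ioi_mul (fun _ : Fin n => (1 : ℤ))
  have h3 : ((vandermondeOrder S : ℕ) : ℤ) =
      ∑ i : Fin n, ∑ j ∈ Finset.Ioi i, (1 : ℤ) * 1 + ∑ i, ∑ j ∈ Finset.Ioi i, e i * e j := by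
    simp only [vandermondeOrder, ← Finset.sum_add_distrib]
    push_cast
    refine Finset.sum_congr rfl fun i _ => Finset.sum_congr rfl fun j _ => ?_
    by_cases hi : i ∈ S <;> by_cases hj : j ∈ S <;> simp [he, hi, hj]
  have h4 : ∑ i, e i ^ 2 = n := by
    have : ∀ i, e i ^ 2 = 1 := fun i => by by_cases hi : i ∈ S <;> simp [he, hi]
    simp [this]
  simp only [one_pow, Finset.sum_const, Finset.card_univ, Fintype.card_fin, nsmul_eq_mul,
    mul_one] at h2 h3
  zify
  nlinarith [sq_nonneg (∑ i, e i)]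

/-! ### Decomposition of the cube and conclusion -/

/-- Inclusion-exclusion for the indicator function of the unit cube. -/
theorem indicator_Icc_eq_sum_mixedOrthant {n : ℕ} (f : (Fin n → ℝ) → ℝ) (x : Fin n → ℝ) :
    {x : Fin n → ℝ | ∀ i, x i ∈ Set.Icc (0 : ℝ) 1}.indicator f x =
      ∑ S : Finset (Fin n), (-1) ^ S.card *
        (mixedOrthant S).indicator (fun y => f (y + vertex S)) (x - vertex S) := by
  classical
  have key : ∀ S : Finset (Fin n),
      (∏ i ∈ S, if 1 < x i then (1 : ℝ) else 0) * (∏ i ∈ Sᶜ, if 0 ≤ x i then (1 : ℝ) else 0) * f x =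
        (mixedOrthant S).indicator (fun y => f (y + vertex S)) (x - vertex S) := by
    intro S
    have hmem : x - vertex S ∈ mixedOrthant S ↔ (∀ i ∈ S, 1 < x i) ∧ ∀ i ∈ Sᶜ, 0 ≤ x i := by
      constructor
      · refine fun h => ⟨fun i hi => ?_, fun i hi => ?_⟩
        · simpa [vertex, hi] using (h i).2 hi
        · simpa [vertex, Finset.mem_compl.1 hi] using (h i).1
      · rintro ⟨h1, h2⟩ i
        by_cases hi : i ∈ S
        · have := h1 i hi
          simp [vertex, hi, this, this.le]
        · have := h2 i (Finset.mem_compl.2 hi)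
          simp [vertex, hi, this]
    rw [Finset.prod_ite_zero, Finset.prod_ite_zero, Set.indicator_apply]
    simp only [hmem, sub_add_cancel, Finset.prod_const_one]
    rw [ite_zero_mul_ite_zero, one_mul, ite_zero_mul, one_mul]
  have hcube : {x : Fin n → ℝ | ∀ i, x i ∈ Set.Icc (0 : ℝ) 1}.indicator f x =
      (∏ i, (-(if 1 < x i then (1 : ℝ) else 0) + if 0 ≤ x i then (1 : ℝ) else 0)) * f x := by
    have : ∀ i, (-(if 1 < x i then (1 : ℝ) else 0) + if 0 ≤ x i then (1 : ℝ) else 0) =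
        if x i ∈ Set.Icc (0 : ℝ) 1 then 1 else 0 := by
      intro i
      simp only [Set.mem_Icc]
      split_ifs <;> first | (exfalso; grind) | norm_num
    simp only [this, Finset.prod_ite_zero, Finset.prod_const_one, Set.indicator_apply]
    simp
  rw [hcube, Finset.prod_add, Finset.powerset_univ, Finset.sum_mul]
  refine Finset.sum_congr rfl fun S _ => ?_
  rw [← key, Finset.prod_neg, ← Finset.compl_eq_univ_sdiff]
  ring

theorem continuous_vandermondeSq {n : ℕ} :
    Continuous (vandermondeSq : (Fin n → ℝ) → ℝ) := by
  unfold vandermondeSq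
  fun_prop

theorem deltaVandermondeIntegral_eq_sum (n : ℕ) (c : ℝ) :
    deltaVandermondeIntegral n c = ∑ S : Finset (Fin (n + 1)), (-1) ^ S.card *
      orthantSliceIntegral S (fun x => vandermondeSq (x + vertex S)) (c - S.card) := by
  have hcont : ∀ S : Finset (Fin (n + 1)),
      Continuous fun x : Fin (n + 1) → ℝ => vandermondeSq (x + vertex S) := fun S =>
    continuous_vandermondeSq.comp (by fun_prop)
  have hmeas : MeasurableSet
      {t : Fin n → ℝ | ∀ i, hyperplanePoint n c t i ∈ Set.Icc (0 : ℝ) 1} := by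
    have : {t : Fin n → ℝ | ∀ i, hyperplanePoint n c t i ∈ Set.Icc (0 : ℝ) 1} =
        hyperplanePoint n c ⁻¹' Set.Icc 0 1 := by
      ext t; simp [Set.mem_Icc, Pi.le_def, forall_and]
    rw [this]
    exact (continuous_hyperplanePoint n c).measurable measurableSet_Icc
  have hcube : ∀ t, {t : Fin n → ℝ | ∀ i, hyperplanePoint n c t i ∈ Set.Icc (0 : ℝ) 1}.indicator
      (fun t => vandermondeSq (hyperplanePoint n c t)) t =
      ∑ S : Finset (Fin (n + 1)), (-1) ^ S.card * (mixedOrthant S).indicator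
        (fun x => vandermondeSq (x + vertex S))
        (hyperplanePoint n (c - S.card) (t - fun i => vertex S i.castSucc)) := by
    intro t
    refine (indicator_Icc_eq_sum_mixedOrthant vandermondeSq (hyperplanePoint n c t)).trans ?_
    simp only [hyperplanePoint_sub, sum_vertex]
  rw [deltaVandermondeIntegral, ← integral_indicator hmeas]
  simp only [hcube]
  rw [integral_finsetSum]
  · refine Finset.sum_congr rfl fun S _ => ?_
    rw [integral_const_mul, orthantSliceIntegral,
      integral_sub_right_eq_self (fun t => (mixedOrthant S).indicator
        (fun x => vandermondeSq (x + vertex S)) (hyperplanePoint n (c - S.card) t))]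
  · intro S _
    exact ((integrable_orthantSlice S (hcont S) (c - S.card)).comp_sub_right _).const_mul _

theorem contDiff_deltaVandermondeIntegral {n : ℕ} (hn : n ≠ 0) :
    ContDiff ℝ ((((n + 1) ^ 2 + 1) / 2 - 2 : ℕ) : WithTop ℕ∞) (deltaVandermondeIntegral n) := by
  rw [funext (deltaVandermondeIntegral_eq_sum n)]
  refine ContDiff.sum fun S _ => contDiff_const.mul ?_
  have hS := sq_le_two_mul_vandermondeOrder S
  -- This keeps the natural-number subtraction of 2 from truncating.
  have h4 : 4 ≤ (n + 1) ^ 2 := by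
    have : 1 ≤ n := by omega
    nlinarith
  exact (contDiff_orthantSliceIntegral hn S (r := vandermondeOrder S) (by omega)
    (vandermondeSq_add_vertex_mem S)).2.comp (contDiff_id.sub contDiff_const)

theorem mainTheorem3 (k : ℕ) (hk : 2 ≤ k) :
    ContDiffOn ℝ (((k ^ 2 + 1) / 2 - 2 : ℕ) : WithTop ℕ∞) (gammaFn k) (Set.Ioo (0 : ℝ) (k : ℝ)) := by
  obtain ⟨n, rfl⟩ : ∃ n, k = n + 1 := ⟨k - 1, by omega⟩
  exact (contDiff_const.mul (contDiff_deltaVandermondeIntegral (by omega))).contDiffOn
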